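/- Let $\mathcal H$ be a real Hilbert space, let $p\ge 1$, and let $\mathcal J:\mathcal H\to\mathbb R\cup\{+\infty\}$ be proper, convex, lower semicontinuous and absolutely $p$-homogeneous, i.e. $\mathcal J(0)=0$ and $\mathcal J(su)=|s|^p\mathcal J(u)$ for all $u\in\mathcal H$ and $s\ne 0$. Assume that all sublevel sets of $u\mapsto\|u\|+\mathcal J(u)$ are precompact. For $u\in\mathcal H$ let $\partial\mathcal J(u)=\{\zeta\in\mathcal H:\ \mathcal J(u)+\langle\zeta,v-u\rangle\le\mathcal J(v)\ \text{for all } v\in\mathcal H\}$. Let $f\in\overline{\mathrm{dom}(\mathcal J)}$ and let $u:[0,\infty)\to\mathcal H$ be the gradient flow of $\mathcal J$ with initial datum $f$, that is, the continuous map that is Lipschitz on $[\delta,\infty)$ for every $\delta>0$ and satisfies $u(0)=f$ and $-u'(t)\in\partial\mathcal J(u(t))$ for almost every $t>0$. Then the limit $u_\infty:=\lim_{t\to\infty}u(t)$ exists. Suppose moreover that $f\ne u_\infty$, and put $$T_{\mathrm{ex}}:=\inf\{t>0:\ u(t)=u_\infty\}\in[0,\infty]\quad(\inf\emptyset=\infty),$$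 and, for $0\le t<T_{\mathrm{ex}}$ (so that $u(t)\neq u_\infty$), $$w(t):=\frac{u(t)-u_\infty}{\|u(t)-u_\infty\|},\qquad \Lambda(t):=\frac{p\,\mathcal J(u(t))}{\|u(t)-u_\infty\|^p}.$$ Then the limit $\Lambda_\infty:=\lim_{t\to T_{\mathrm{ex}}^-}\Lambda(t)$ exists, is finite, and equals $\inf_{0<t<T_{\mathrm{ex}}}\Lambda(t)$. Furthermore there exist a non-decreasing sequence $(t_n)_{n\in\mathbb N}\subset[0,T_{\mathrm{ex}})$ with $t_n\to T_{\mathrm{ex}}$ and an element $w_\infty\in\mathcal H$ with $\|w_\infty\|=1$ such that $$\lim_{n\to\infty}w(t_n)=w_\infty\qquad\text{and}\qquad \Lambda_\infty w_\infty\in\partial\mathcal J(w_\infty).$$ In particular $w_\infty\neq0$ is an eigenfunction of $\partial\mathcal J$ with eigenvalue $\Lambda_\infty$. -/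

import Mathlib

open Filter Topology MeasureTheory

namespace GradFlow

variable {H : Type*} [NormedAddCommGroup H] [InnerProductSpace ℝ H]

/-- Effective domain of a functional with values in `ℝ ∪ {+∞}`. -/
def dom (J : H → EReal) : Set H := {v | J v < ⊤}

/-- `J` takes values in `ℝ ∪ {+∞}` and is not identically `+∞`. -/
def IsProper (J : H → EReal) : Prop := (∀ v, J v ≠ ⊥) ∧ (dom J).Nonempty

/-- Convexity of an extended-valued functional. -/
def IsConvex (J : H → EReal) : Prop :=
  ∀ x y : H, ∀ α : ℝ, 0 < α → α < 1 →
    J (α • x + (1 - α) • y) ≤ (α : EReal) * J x + ((1 - α : ℝ) : EReal) * J y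

/-- Absolute `p`-homogeneity: `J (s v) = |s| ^ p J v` for `s ≠ 0`, and `J 0 = 0`. -/
def IsAbsHomogeneous (p : ℝ) (J : H → EReal) : Prop :=
  J 0 = 0 ∧ ∀ (s : ℝ) (v : H), s ≠ 0 → J (s • v) = ((|s| ^ p : ℝ) : EReal) * J v

/-- All sublevel sets of `v ↦ ‖v‖ + J v` are precompact. -/
def HasPrecompactSublevels (J : H → EReal) : Prop :=
  ∀ c : ℝ, IsCompact (closure {v : H | ((‖v‖ : ℝ) : EReal) + J v ≤ (c : EReal)})

/-- The subdifferential of `J` at `v`, the dual of `H` being identified with `H`. -/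
def subdiff (J : H → EReal) (v : H) : Set H :=
  {ζ | ∀ x : H, J v + ((inner ℝ ζ (x - v) : ℝ) : EReal) ≤ J x}

/-- `u`, restricted to `[0, ∞)`, is the gradient flow of `J` with initial datum `f`. -/
structure IsGradientFlow (J : H → EReal) (f : H) (u : ℝ → H) : Prop where
  continuousOn : ContinuousOn u (Set.Ici 0)
  lipschitz : ∀ δ : ℝ, 0 < δ → ∃ K : NNReal, LipschitzOnWith K u (Set.Ici δ)
  initial : u 0 = f
  inclusion : ∀ᵐ t ∂(volume.restrict (Set.Ioi (0 : ℝ))),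
    ∃ v : H, HasDerivAt u v t ∧ -v ∈ subdiff J (u t)

/-- The extinction time `inf {t > 0 : u t = uinf}`, equal to `⊤` if there is no such `t`. -/
noncomputable def extinctionTime (u : ℝ → H) (uinf : H) : EReal :=
  sInf ((fun t : ℝ => (t : EReal)) '' {t : ℝ | 0 < t ∧ u t = uinf})

/-- The filter of real numbers `t` tending to `T` from below. -/
noncomputable def toTimeLeft (T : EReal) : Filter ℝ := comap (fun t : ℝ => (t : EReal)) (𝓝[<] T)

/-- The Rayleigh quotient `p J(u t) / ‖u t - uinf‖ ^ p` along the flow. -/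
noncomputable def rayleigh (J : H → EReal) (p : ℝ) (u : ℝ → H) (uinf : H) (t : ℝ) : EReal :=
  (p : EReal) * J (u t) / ((‖u t - uinf‖ ^ p : ℝ) : EReal)

/-- The normalized flow `(u t - uinf) / ‖u t - uinf‖`. -/
noncomputable def profile (u : ℝ → H) (uinf : H) (t : ℝ) : H :=
  ‖u t - uinf‖⁻¹ • (u t - uinf)

end GradFlow

/-!
Throughout, `v = u - q` with `q` the limit of the flow, `ζ = -u'` is the subgradient driving the
flow, and `Λ = p J(u) / ‖v‖ ^ p`.

*Energy identity.* The subgradient inequality at almost every time, extended to every time by lower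
semicontinuity, shows that `J ∘ u` is finite and Lipschitz on every `[δ, ∞)`
(`energy_lipschitzOnWith`). At a time where both `u` and `J ∘ u` are differentiable the same
inequality forces `(J ∘ u)' = -‖ζ‖ ^ 2` (`ae_hasDerivAt_energy`). All monotonicity statements then
follow from the fundamental theorem of calculus for absolutely continuous functions.

*The limit.* If `J q = 0`, convexity and homogeneity make `J` invariant under translation by `q`
(`map_add_of_map_eq_zero`), so Euler's identity gives `⟪ζ, u - q⟫ = p J(u)` and
`(‖u - q‖ ^ 2)' = -2 p J(u) ≤ 0`. Hence `J (u t) → 0`. By compactness `u` has a limit point `q`,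
where `J` vanishes by lower semicontinuity, and since the distance to `q` is non-increasing the
whole flow converges to it (`exists_tendsto_flow`). No Poincaré inequality or projection onto the
null space of `J` is needed.

*The eigenvector.* The rescaled subgradient `η = ‖v‖ ^ (1 - p) ζ` lies in the subdifferential at the
profile `w = v / ‖v‖`, and Euler's identity gives
`‖η - Λ w‖ ^ 2 = ‖η‖ ^ 2 - Λ ^ 2 =: D ≥ 0`. A computation yields
`(Λ ^ 2 - 2 c log ‖v‖)' = 2 Λ ‖v‖ ^ (p - 2) (c - p D)` (`hasDerivAt_lyapunov`). With `c = 0` this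
says that `Λ` is non-increasing, so it converges to its infimum. If `D` were at least `ε > 0` at all
late times, the choice `c = p ε` would keep `Λ ^ 2 - 2 c log ‖v‖` bounded above, although
`log ‖v‖ → -∞`; so there are times tending to the extinction time along which `D → 0`
(`exists_defect_lt`). Along them `w` has a convergent subsequence because `J w = Λ / p` is bounded,
and the closedness of the subdifferential turns `η - Λ w → 0` into the eigenvalue equation.
-/

open Filter Topology MeasureTheory

namespace GradFlow

variable {H : Type*} [NormedAddCommGroup H] [InnerProductSpace ℝ H]


/-! ### Homogeneous convex functionals -/

theorem IsAbsHomogeneous.map_smul_coe {p : ℝ} {J : H → EReal} (hhom : IsAbsHomogeneous p J)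
    {s : ℝ} (hs : s ≠ 0) {v : H} {j : ℝ} (hj : J v = j) :
    J (s • v) = ((|s| ^ p * j : ℝ) : EReal) := by
  rw [hhom.2 s v hs, hj, EReal.coe_mul]

theorem IsConvex.le_coe {J : H → EReal} (hconv : IsConvex J) {x y : H} {a b : ℝ}
    (hx : J x = a) (hy : J y = b) {α : ℝ} (h0 : 0 < α) (h1 : α < 1) :
    J (α • x + (1 - α) • y) ≤ ((α * a + (1 - α) * b : ℝ) : EReal) := by
  have h := hconv x y α h0 h1
  rw [hx, hy] at h
  exact_mod_cast h

theorem eq_coe_of_ne_top {X : Type*} {J : X → EReal} (hproper : IsProper J) {v : X}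
    (hv : J v ≠ ⊤) :
    J v = ((J v).toReal : EReal) :=
  (EReal.coe_toReal hv (hproper.1 v)).symm

/-- Convexity between `v` and `-v`, where `J` takes the same value, bounds `J v` below by
`J 0 = 0`. -/
theorem nonneg_of_isAbsHomogeneous {p : ℝ} {J : H → EReal} (hhom : IsAbsHomogeneous p J)
    (hproper : IsProper J) (hconv : IsConvex J) (v : H) : 0 ≤ J v := by
  by_cases hv : J v = ⊤
  · simp [hv]
  have hj := eq_coe_of_ne_top hproper hv
  have hneg : J ((-1 : ℝ) • v) = ((J v).toReal : EReal) := by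
    rw [hhom.map_smul_coe (by norm_num) hj]; simp
  have h := hconv.le_coe hj hneg (α := 1 / 2) (by norm_num) (by norm_num)
  have h0 : (1 / 2 : ℝ) • v + (1 - 1 / 2 : ℝ) • ((-1 : ℝ) • v) = 0 := by module
  rw [h0, hhom.1] at h
  rw [hj]
  have h' : (0 : ℝ) ≤ 1 / 2 * (J v).toReal + (1 - 1 / 2) * (J v).toReal := by exact_mod_cast h
  have : (0 : ℝ) ≤ (J v).toReal := by linarith
  exact_mod_cast this

theorem subdiff_le_coe {J : H → EReal} {v x ζ : H} (hζ : ζ ∈ subdiff J v) {a b : ℝ}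
    (hv : J v = a) (hx : J x = b) : a + inner ℝ ζ (x - v) ≤ b := by
  have h := hζ x
  rw [hv, hx] at h
  exact_mod_cast h

/-- Euler's identity for a `p`-homogeneous functional. -/
theorem inner_eq_of_mem_subdiff {p : ℝ} {J : H → EReal} (hhom : IsAbsHomogeneous p J)
    {v ζ : H} (hζ : ζ ∈ subdiff J v) {j : ℝ} (hj : J v = j) : inner ℝ ζ v = p * j := by
  -- `s ↦ J (s v) - J v - ⟪ζ, (s - 1) v⟫` is non-negative near `s = 1`, where it vanishes.
  have hd : HasDerivAt (fun s : ℝ => s ^ p * j - j - (s - 1) * inner ℝ ζ v)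
      (p * 1 ^ (p - 1) * j - 1 * inner ℝ ζ v) 1 := by
    have h1 := Real.hasDerivAt_rpow_const (x := 1) (p := p) (Or.inl one_ne_zero)
    exact ((h1.mul_const j).sub_const j).sub (((hasDerivAt_id 1).sub_const 1).mul_const _)
  have hmin : IsLocalMin (fun s : ℝ => s ^ p * j - j - (s - 1) * inner ℝ ζ v) 1 := by
    filter_upwards [lt_mem_nhds (zero_lt_one (α := ℝ))] with s hs
    have h := subdiff_le_coe hζ hj (hhom.map_smul_coe hs.ne' hj)
    have e : s • v - v = (s - 1) • v := by module
    rw [abs_of_pos hs, e, inner_smul_right] at h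
    simp only [Real.one_rpow, sub_self, zero_mul, one_mul]
    linarith
  have h := hmin.hasDerivAt_eq_zero hd
  simp only [Real.one_rpow, mul_one, one_mul] at h
  linarith

/-- The functional does not increase along its null directions: write `v + q` as the convex
combination `(1 - ε) ((1 - ε)⁻¹ v) + ε (ε⁻¹ q)` and let `ε → 0`. -/
theorem map_add_le_of_map_eq_zero {p : ℝ} {J : H → EReal} (hhom : IsAbsHomogeneous p J)
    (hproper : IsProper J) (hconv : IsConvex J) {q : H} (hq : J q = 0) (v : H) :
    J (v + q) ≤ J v := by
  by_cases hv : J v = ⊤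
  · simp [hv]
  have hj := eq_coe_of_ne_top hproper hv
  set j := (J v).toReal
  rw [hj]
  have hlim : Tendsto (fun a : ℝ => ((a * (|a⁻¹| ^ p * j) : ℝ) : EReal)) (𝓝[<] 1)
      (𝓝 (j : EReal)) := by
    refine EReal.tendsto_coe.2 (Tendsto.mono_left ?_ nhdsWithin_le_nhds)
    have hc : ContinuousAt (fun a : ℝ => a * (|a⁻¹| ^ p * j)) 1 := by
      have h1 : ContinuousAt (fun a : ℝ => |a⁻¹|) 1 :=
        (continuousAt_inv₀ one_ne_zero).abs
      exact continuousAt_id.mul ((h1.rpow_const (Or.inl (by simp))).mul continuousAt_const)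
    simpa [ContinuousAt] using hc
  refine ge_of_tendsto hlim ?_
  have hpos : ∀ᶠ a : ℝ in 𝓝[<] 1, 0 < a :=
    nhdsWithin_le_nhds (lt_mem_nhds zero_lt_one)
  filter_upwards [hpos, self_mem_nhdsWithin] with a ha0 ha1
  have ha1 : a < 1 := ha1
  have hb : (1 - a) ≠ 0 := by linarith
  have hq' : J ((1 - a)⁻¹ • q) = ((0 : ℝ) : EReal) := by
    rw [hhom.map_smul_coe (inv_ne_zero hb) (j := 0) (by simpa using hq)]; simp
  have h := hconv.le_coe (hhom.map_smul_coe (inv_ne_zero ha0.ne') hj) hq' ha0 ha1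
  rw [smul_inv_smul₀ ha0.ne', smul_inv_smul₀ hb, mul_zero, add_zero] at h
  exact h

theorem map_add_of_map_eq_zero {p : ℝ} {J : H → EReal} (hhom : IsAbsHomogeneous p J)
    (hproper : IsProper J) (hconv : IsConvex J) {q : H} (hq : J q = 0) (v : H) :
    J (v + q) = J v := by
  refine le_antisymm (map_add_le_of_map_eq_zero hhom hproper hconv hq v) ?_
  have hq' : J (-q) = 0 := by
    have h := hhom.map_smul_coe (s := -1) (v := q) (j := 0) (by norm_num) (by simpa using hq)
    simpa using h
  simpa using map_add_le_of_map_eq_zero hhom hproper hconv hq' (v + q)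

theorem map_sub_of_map_eq_zero {p : ℝ} {J : H → EReal} (hhom : IsAbsHomogeneous p J)
    (hproper : IsProper J) (hconv : IsConvex J) {q : H} (hq : J q = 0) (v : H) :
    J (v - q) = J v := by
  simpa using (map_add_of_map_eq_zero hhom hproper hconv hq (v - q)).symm

theorem mem_subdiff_sub {p : ℝ} {J : H → EReal} (hhom : IsAbsHomogeneous p J)
    (hproper : IsProper J) (hconv : IsConvex J) {q : H} (hq : J q = 0) {v ζ : H}
    (hζ : ζ ∈ subdiff J v) : ζ ∈ subdiff J (v - q) := by
  intro x
  have h := hζ (x + q)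
  rw [map_add_of_map_eq_zero hhom hproper hconv hq] at h
  rw [map_sub_of_map_eq_zero hhom hproper hconv hq]
  have e : x + q - v = x - (v - q) := by abel
  rwa [e] at h

/-- The subdifferential of a `p`-homogeneous functional is `(p - 1)`-homogeneous. -/
theorem smul_mem_subdiff {p : ℝ} {J : H → EReal} (hhom : IsAbsHomogeneous p J)
    (hproper : IsProper J) {v ζ : H} (hζ : ζ ∈ subdiff J v) {j : ℝ} (hj : J v = j)
    {s : ℝ} (hs : 0 < s) : s ^ (p - 1) • ζ ∈ subdiff J (s • v) := by
  intro x
  by_cases hx : J x = ⊤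
  · simp [hx]
  have hxj := eq_coe_of_ne_top hproper hx
  have hx' := hhom.map_smul_coe (inv_ne_zero hs.ne') hxj
  have h := subdiff_le_coe hζ hj hx'
  rw [hhom.map_smul_coe hs.ne' hj, hxj]
  rw [abs_of_pos (inv_pos.2 hs), Real.inv_rpow hs.le] at h
  have hsp : 0 < s ^ p := Real.rpow_pos_of_pos hs p
  have hmul : s ^ p = s ^ (p - 1) * s := by
    rw [← Real.rpow_add_one hs.ne']; simp
  have key : |s| ^ p * j + inner ℝ (s ^ (p - 1) • ζ) (x - s • v) ≤ (J x).toReal := by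
    have e : x - s • v = s • (s⁻¹ • x - v) := by
      rw [smul_sub, smul_inv_smul₀ hs.ne']
    rw [e, real_inner_smul_left, real_inner_smul_right, abs_of_pos hs]
    calc s ^ p * j + s ^ (p - 1) * (s * inner ℝ ζ (s⁻¹ • x - v))
        = s ^ p * (j + inner ℝ ζ (s⁻¹ • x - v)) := by rw [hmul]; ring
      _ ≤ s ^ p * ((s ^ p)⁻¹ * (J x).toReal) := by gcongr
      _ = (J x).toReal := by field_simp
  exact_mod_cast key

/-- Lower semicontinuity along a sequence, with real bounds. -/
theorem le_of_tendsto_of_le {X : Type*} [TopologicalSpace X] {J : X → EReal}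
    (hlsc : LowerSemicontinuous J) {w : ℕ → X} {w' : X}
    (hw : Tendsto w atTop (𝓝 w')) {b : ℕ → ℝ} {b' : ℝ} (hb : Tendsto b atTop (𝓝 b'))
    (hle : ∀ n, J (w n) ≤ (b n : EReal)) : J w' ≤ (b' : EReal) := by
  refine le_of_forall_lt fun c hc => ?_
  obtain ⟨d, hcd, hdJ⟩ := exists_between hc
  exact hcd.trans_le (ge_of_tendsto (EReal.tendsto_coe.2 hb)
    ((hw.eventually (hlsc w' d hdJ)).mono fun n hn => hn.le.trans (hle n)))

/-- The graph of the subdifferential is closed for strong convergence in both variables. -/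
theorem mem_subdiff_of_tendsto {J : H → EReal} (hproper : IsProper J)
    (hlsc : LowerSemicontinuous J) {w η : ℕ → H} {w' η' : H} (hw : Tendsto w atTop (𝓝 w'))
    (hη : Tendsto η atTop (𝓝 η')) (hmem : ∀ n, η n ∈ subdiff J (w n)) : η' ∈ subdiff J w' := by
  intro x
  by_cases hx : J x = ⊤
  · simp [hx]
  have hxj := eq_coe_of_ne_top hproper hx
  have hle : ∀ n, J (w n) ≤ (((J x).toReal - inner ℝ (η n) (x - w n) : ℝ) : EReal) := by
    intro n
    have h := hmem n x
    have hfin : J (w n) ≠ ⊤ := by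
      intro htop
      rw [htop, EReal.top_add_coe] at h
      exact hx (top_le_iff.1 h)
    have hwj := eq_coe_of_ne_top hproper hfin
    have h' := subdiff_le_coe (hmem n) hwj hxj
    rw [hwj]
    exact_mod_cast (by linarith : (J (w n)).toReal ≤ (J x).toReal - inner ℝ (η n) (x - w n))
  have hJw : J w' ≤ (((J x).toReal - inner ℝ η' (x - w') : ℝ) : EReal) :=
    le_of_tendsto_of_le hlsc hw
      (tendsto_const_nhds.sub (hη.inner (tendsto_const_nhds.sub hw))) hle
  have hfin : J w' ≠ ⊤ := fun h => by
    rw [h] at hJw; exact EReal.coe_ne_top _ (top_le_iff.1 hJw)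
  have hwj := eq_coe_of_ne_top hproper hfin
  rw [hwj] at hJw ⊢
  rw [hxj]
  have h1 : (J w').toReal ≤ (J x).toReal - inner ℝ η' (x - w') := by exact_mod_cast hJw
  exact_mod_cast (by linarith : (J w').toReal + inner ℝ η' (x - w') ≤ (J x).toReal)

/-- The standing assumptions on the functional, apart from precompactness of sublevels. -/
structure IsHomogeneousFunctional (p : ℝ) (J : H → EReal) : Prop where
  hom : IsAbsHomogeneous p J
  proper : IsProper J
  convex : IsConvex J
  lsc : LowerSemicontinuous J

/-! ### Almost everywhere statements on the half-line -/

theorem exists_seq_tendsto_of_ae {P : ℝ → Prop}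
    (hP : ∀ᵐ t ∂(volume.restrict (Set.Ioi (0 : ℝ))), P t)
    {a t : ℝ} (ha : 0 ≤ a) (hat : a < t) :
    ∃ s : ℕ → ℝ, Tendsto s atTop (𝓝 t) ∧ ∀ n, a < s n ∧ P (s n) := by
  rw [ae_restrict_iff' measurableSet_Ioi] at hP
  have hd : Dense {s : ℝ | s ∈ Set.Ioi (0 : ℝ) → P s} := Measure.dense_of_ae hP
  obtain ⟨s, hs, hst⟩ := mem_closure_iff_seq_limit.1 (hd t)
  obtain ⟨N, hN⟩ := eventually_atTop.1 (hst.eventually (lt_mem_nhds hat))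
  refine ⟨fun n => s (n + N), (tendsto_add_atTop_iff_nat N).2 hst, fun n => ?_⟩
  have h := hN (n + N) (Nat.le_add_left _ _)
  exact ⟨h, hs _ (ha.trans_lt h)⟩

theorem le_of_ae_hasDerivAt_nonpos {g : ℝ → ℝ} {a b : ℝ} (hab : a ≤ b)
    (hg : AbsolutelyContinuousOnInterval g a b)
    (hd : ∀ᵐ t, t ∈ Set.Ioo a b → ∃ g', HasDerivAt g g' t ∧ g' ≤ 0) : g b ≤ g a := by
  have h := hg.integral_deriv_eq_sub
  have h0 : 0 ≤ ∫ t in a..b, -deriv g t := by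
    refine intervalIntegral.integral_nonneg_of_ae_restrict hab ?_
    rw [Filter.EventuallyLE, ← restrict_Ioo_eq_restrict_Icc, ae_restrict_iff' measurableSet_Ioo]
    filter_upwards [hd] with t ht hmem
    obtain ⟨g', hg', hle⟩ := ht hmem
    simpa [hg'.deriv] using hle
  rw [intervalIntegral.integral_neg] at h0
  linarith

/-! ### Energy dissipation along the flow -/

/-- The energy `J (u t)` as a real number; it is finite for `t > 0`, see `energy_coe`. -/
noncomputable def energy (J : H → EReal) (u : ℝ → H) (t : ℝ) : ℝ := (J (u t)).toReal

/-- A time at which the gradient flow has a strong derivative `-ζ` with `ζ` a subgradient. -/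
def IsDescent (J : H → EReal) (u : ℝ → H) (t : ℝ) (ζ : H) : Prop :=
  HasDerivAt u (-ζ) t ∧ ζ ∈ subdiff J (u t)

variable {p : ℝ} {J : H → EReal} {f : H} {u : ℝ → H}

theorem IsGradientFlow.ae_isDescent (hu : IsGradientFlow J f u) :
    ∀ᵐ t ∂(volume.restrict (Set.Ioi (0 : ℝ))), ∃ ζ, IsDescent J u t ζ := by
  filter_upwards [hu.inclusion] with t ⟨v, hv, hmem⟩
  exact ⟨-v, by simpa using hv, hmem⟩

/-- On `[δ, ∞)` the energy has slope at most the Lipschitz constant of the flow. At almost every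
time this is the subgradient inequality; lower semicontinuity extends it to every time. -/
theorem map_flow_le (hJ : IsHomogeneousFunctional p J) (hu : IsGradientFlow J f u) {δ : ℝ}
    (hδ : 0 < δ) : ∃ K : NNReal, LipschitzOnWith K u (Set.Ici δ) ∧ ∀ t, δ ≤ t → ∀ x : H, ∀ c : ℝ,
      J x = c → J (u t) ≤ ((c + K * ‖x - u t‖ : ℝ) : EReal) := by
  obtain ⟨K, hK⟩ := hu.lipschitz (δ / 2) (by positivity)
  refine ⟨K, hK.mono (Set.Ici_subset_Ici.2 (by linarith)), fun t ht x c hx => ?_⟩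
  obtain ⟨s, hst, hs⟩ := exists_seq_tendsto_of_ae hu.ae_isDescent
    (a := δ / 2) (t := t) (by positivity) (by linarith)
  have hcont : ContinuousAt u t :=
    hK.continuousOn.continuousAt (Ici_mem_nhds (by linarith))
  have hus : Tendsto (fun n => u (s n)) atTop (𝓝 (u t)) := hcont.tendsto.comp hst
  refine le_of_tendsto_of_le hJ.lsc hus
    (b := fun n => c + K * ‖x - u (s n)‖) ?_ fun n => ?_
  · exact tendsto_const_nhds.add (tendsto_const_nhds.mul (tendsto_const_nhds.sub hus).norm)
  · obtain ⟨hsn, ζ, hζ, hmem⟩ := hs n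
    have hζK : ‖ζ‖ ≤ K := by
      have h := hζ.le_of_lipschitzOn (Ici_mem_nhds hsn) hK
      rwa [norm_neg] at h
    have hfin : J (u (s n)) ≠ ⊤ := by
      intro htop
      have h := hmem x
      rw [htop, EReal.top_add_coe, hx] at h
      exact EReal.coe_ne_top _ (top_le_iff.1 h)
    have hj := eq_coe_of_ne_top hJ.proper hfin
    have h := subdiff_le_coe hmem hj hx
    have h2 : -inner ℝ ζ (x - u (s n)) ≤ K * ‖x - u (s n)‖ :=
      calc -inner ℝ ζ (x - u (s n)) ≤ |inner ℝ ζ (x - u (s n))| := neg_le_abs _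
        _ ≤ ‖ζ‖ * ‖x - u (s n)‖ := abs_real_inner_le_norm _ _
        _ ≤ K * ‖x - u (s n)‖ := by gcongr
    rw [hj]
    exact_mod_cast (by linarith : (J (u (s n))).toReal ≤ c + K * ‖x - u (s n)‖)

theorem energy_coe (hJ : IsHomogeneousFunctional p J) (hu : IsGradientFlow J f u) {t : ℝ}
    (ht : 0 < t) : J (u t) = (energy J u t : EReal) := by
  obtain ⟨K, -, hK⟩ := map_flow_le hJ hu ht
  refine eq_coe_of_ne_top hJ.proper fun htop => ?_
  have h := hK t le_rfl 0 0 (by simpa using hJ.hom.1)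
  rw [htop] at h
  exact EReal.coe_ne_top _ (top_le_iff.1 h)

theorem energy_nonneg (hJ : IsHomogeneousFunctional p J) (t : ℝ) : 0 ≤ energy J u t :=
  EReal.toReal_nonneg (nonneg_of_isAbsHomogeneous hJ.hom hJ.proper hJ.convex _)

theorem energy_lipschitzOnWith (hJ : IsHomogeneousFunctional p J) (hu : IsGradientFlow J f u)
    {δ : ℝ} (hδ : 0 < δ) : ∃ K : NNReal, LipschitzOnWith K (energy J u) (Set.Ici δ) := by
  obtain ⟨K, hKu, hK⟩ := map_flow_le hJ hu hδ
  refine ⟨K * K, LipschitzOnWith.of_le_add_mul _ fun t ht s hs => ?_⟩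
  have h := hK t ht (u s) _ (energy_coe hJ hu (hδ.trans_le hs))
  rw [energy_coe hJ hu (hδ.trans_le ht)] at h
  have h' : energy J u t ≤ energy J u s + K * ‖u s - u t‖ := by exact_mod_cast h
  have h2 : ‖u s - u t‖ ≤ K * dist t s := by
    rw [← dist_eq_norm, dist_comm]; exact hKu.dist_le_mul t ht s hs
  calc energy J u t ≤ energy J u s + K * ‖u s - u t‖ := h'
    _ ≤ energy J u s + K * (K * dist t s) := by gcongr
    _ = energy J u s + ↑(K * K) * dist t s := by push_cast; ring

theorem ae_differentiableAt_energy (hJ : IsHomogeneousFunctional p J)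
    (hu : IsGradientFlow J f u) : ∀ᵐ t, 0 < t → DifferentiableAt ℝ (energy J u) t := by
  have h : ∀ n : ℕ, ∀ᵐ t, t ∈ Set.Ici (1 / ((n : ℝ) + 1)) →
      DifferentiableWithinAt ℝ (energy J u) (Set.Ici (1 / ((n : ℝ) + 1))) t := fun n => by
    obtain ⟨K, hK⟩ := energy_lipschitzOnWith hJ hu (δ := 1 / ((n : ℝ) + 1)) (by positivity)
    exact hK.ae_differentiableWithinAt_of_mem_real
  filter_upwards [ae_all_iff.2 h] with t ht h0
  obtain ⟨n, hn⟩ := exists_nat_one_div_lt h0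
  exact (ht n hn.le).differentiableAt (Ici_mem_nhds hn)

/-- At a descent time where the energy is differentiable, the derivative is `-‖ζ‖ ^ 2`: the
subgradient inequality says that `s ↦ J (u s) - ⟪ζ, u s - u t⟫` is minimal at `s = t`. -/
theorem ae_hasDerivAt_energy (hJ : IsHomogeneousFunctional p J) (hu : IsGradientFlow J f u) :
    ∀ᵐ t, 0 < t → ∃ ζ, IsDescent J u t ζ ∧ HasDerivAt (energy J u) (-‖ζ‖ ^ 2) t := by
  have hdesc := hu.ae_isDescent
  rw [ae_restrict_iff' measurableSet_Ioi] at hdesc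
  filter_upwards [hdesc, ae_differentiableAt_energy hJ hu] with t h1 h2 ht
  obtain ⟨ζ, hζ⟩ := h1 ht
  refine ⟨ζ, hζ, ?_⟩
  have he := (h2 ht).hasDerivAt
  have hd : HasDerivAt (fun s => energy J u s - inner ℝ ζ (u s - u t))
      (deriv (energy J u) t - inner ℝ ζ (-ζ)) t := by
    have h := (hasDerivAt_const t ζ).inner ℝ (hζ.1.sub_const (u t))
    simp only [inner_zero_left, add_zero] at h
    exact he.sub h
  have hmin : IsLocalMin (fun s => energy J u s - inner ℝ ζ (u s - u t)) t := by
    filter_upwards [lt_mem_nhds ht] with s hs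
    have h := subdiff_le_coe hζ.2 (energy_coe hJ hu ht) (energy_coe hJ hu hs)
    simp only [sub_self, inner_zero_right, sub_zero]
    linarith
  have h0 := hmin.hasDerivAt_eq_zero hd
  rw [inner_neg_right, real_inner_self_eq_norm_sq] at h0
  have : deriv (energy J u) t = -‖ζ‖ ^ 2 := by linarith
  rwa [this] at he

theorem energy_antitoneOn (hJ : IsHomogeneousFunctional p J) (hu : IsGradientFlow J f u) :
    AntitoneOn (energy J u) (Set.Ioi 0) := by
  intro a ha b _ hab
  obtain ⟨K, hK⟩ := energy_lipschitzOnWith hJ hu ha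
  refine le_of_ae_hasDerivAt_nonpos hab (LipschitzOnWith.absolutelyContinuousOnInterval
    (hK.mono (by rw [Set.uIcc_of_le hab]; exact Set.Icc_subset_Ici_self))) ?_
  filter_upwards [ae_hasDerivAt_energy hJ hu] with t ht hmem
  obtain ⟨ζ, -, hd⟩ := ht (lt_trans ha hmem.1)
  exact ⟨_, hd, by nlinarith [sq_nonneg ‖ζ‖]⟩

/-! ### Convergence of the flow -/

theorem inner_sub_of_map_eq_zero (hJ : IsHomogeneousFunctional p J) {q v ζ : H} (hq : J q = 0)
    (hζ : ζ ∈ subdiff J v) {j : ℝ} (hj : J v = j) : inner ℝ ζ (v - q) = p * j :=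
  inner_eq_of_mem_subdiff hJ.hom (mem_subdiff_sub hJ.hom hJ.proper hJ.convex hq hζ)
    ((map_sub_of_map_eq_zero hJ.hom hJ.proper hJ.convex hq v).trans hj)

theorem hasDerivAt_norm_sub_sq (hJ : IsHomogeneousFunctional p J) (hu : IsGradientFlow J f u)
    {q ζ : H} (hq : J q = 0) {t : ℝ} (ht : 0 < t) (hζ : IsDescent J u t ζ) :
    HasDerivAt (fun s => ‖u s - q‖ ^ 2) (-(2 * p * energy J u t)) t := by
  have h := (hζ.1.sub_const q).norm_sq
  rw [inner_neg_right, real_inner_comm,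
    inner_sub_of_map_eq_zero hJ hq hζ.2 (energy_coe hJ hu ht)] at h
  convert h using 1
  ring

theorem lipschitzOnWith_norm_sub (hu : IsGradientFlow J f u) (q : H) {a : ℝ}
    (ha : 0 < a) : ∃ K : NNReal, LipschitzOnWith K (fun s => ‖u s - q‖) (Set.Ici a) := by
  obtain ⟨K, hK⟩ := hu.lipschitz a ha
  refine ⟨K, LipschitzOnWith.of_le_add_mul _ fun t ht s hs => ?_⟩
  have h := hK.dist_le_mul t ht s hs
  rw [dist_eq_norm] at h
  have h2 := norm_sub_le_norm_sub_add_norm_sub (u t) (u s) q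
  linarith

theorem absolutelyContinuous_norm_sub_sq (hu : IsGradientFlow J f u) (q : H) {a b : ℝ}
    (ha : 0 < a) (hab : a ≤ b) :
    AbsolutelyContinuousOnInterval (fun s => ‖u s - q‖ ^ 2) a b := by
  obtain ⟨K, hK⟩ := lipschitzOnWith_norm_sub hu q ha
  have h := LipschitzOnWith.absolutelyContinuousOnInterval
    (hK.mono (by rw [Set.uIcc_of_le hab]; exact Set.Icc_subset_Ici_self) :
      LipschitzOnWith K (fun s => ‖u s - q‖) (Set.uIcc a b))
  simpa only [sq] using h.fun_mul h

/-- Quantitative decay of the distance to a null vector while the energy stays above `c`. -/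
theorem norm_sub_sq_add_le (hp : 1 ≤ p) (hJ : IsHomogeneousFunctional p J)
    (hu : IsGradientFlow J f u) {q : H} (hq : J q = 0) {a b c : ℝ} (ha : 0 < a) (hab : a ≤ b)
    (hc : c ≤ energy J u b) :
    ‖u b - q‖ ^ 2 + 2 * p * c * (b - a) ≤ ‖u a - q‖ ^ 2 := by
  have hlin : AbsolutelyContinuousOnInterval (fun t : ℝ => 2 * p * c * (t - a)) a b := by
    refine AbsolutelyContinuousOnInterval.const_mul _ ?_
    exact LipschitzOnWith.absolutelyContinuousOnInterval (K := 1)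
      ((LipschitzWith.id.sub (LipschitzWith.const a)).weaken (by simp)).lipschitzOnWith
  have h := le_of_ae_hasDerivAt_nonpos hab
    ((absolutelyContinuous_norm_sub_sq hu q ha hab).add hlin) (by
      filter_upwards [ae_hasDerivAt_energy hJ hu] with t ht hmem
      have ht0 : 0 < t := ha.trans hmem.1
      obtain ⟨ζ, hζ, -⟩ := ht ht0
      have hct : c ≤ energy J u t :=
        hc.trans (energy_antitoneOn hJ hu ht0 (ha.trans_le hab) hmem.2.le)
      exact ⟨_, (hasDerivAt_norm_sub_sq hJ hu hq ht0 hζ).add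
        (((hasDerivAt_id t).sub_const a).const_mul (2 * p * c)), by nlinarith⟩)
  simpa using h

theorem norm_sub_antitoneOn (hp : 1 ≤ p) (hJ : IsHomogeneousFunctional p J)
    (hu : IsGradientFlow J f u) {q : H} (hq : J q = 0) :
    AntitoneOn (fun t => ‖u t - q‖) (Set.Ioi 0) := by
  intro a ha b hb hab
  have h := norm_sub_sq_add_le hp hJ hu hq ha hab (c := 0) (energy_nonneg hJ b)
  exact (sq_le_sq₀ (norm_nonneg _) (norm_nonneg _)).1 (by linarith)

theorem tendsto_energy_zero (hp : 1 ≤ p) (hJ : IsHomogeneousFunctional p J)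
    (hu : IsGradientFlow J f u) : Tendsto (energy J u) atTop (𝓝 0) := by
  refine tendsto_order.2 ⟨fun c hc => Eventually.of_forall fun t =>
    hc.trans_le (energy_nonneg hJ t), fun c hc => ?_⟩
  -- If the energy were still at least `c` at time `b`, the decay estimate with `q = 0` on `[1, b]`
  -- would use up more than `‖u 1‖ ^ 2`.
  set b := 1 + ‖u 1‖ ^ 2 / (2 * p * c) + 1 with hb
  have hpc : 0 < 2 * p * c := by positivity
  have hb1 : 1 ≤ b := by
    have : 0 ≤ ‖u 1‖ ^ 2 / (2 * p * c) := by positivity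
    linarith
  filter_upwards [eventually_ge_atTop b] with t ht
  refine lt_of_le_of_lt (energy_antitoneOn hJ hu (zero_lt_one.trans_le hb1)
    ((zero_lt_one.trans_le hb1).trans_le ht) ht) ?_
  by_contra! hcon
  have h := norm_sub_sq_add_le hp hJ hu hJ.hom.1 zero_lt_one hb1 hcon
  have e : 2 * p * c * (b - 1) = ‖u 1‖ ^ 2 + 2 * p * c := by
    rw [hb]; field_simp; ring
  rw [e, sub_zero, sub_zero] at h
  nlinarith [sq_nonneg ‖u b‖]

/-- The flow converges: by compactness it has a limit point `q`, where `J` vanishes, and the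
distance of the flow to such a point is non-increasing. -/
theorem exists_tendsto_flow (hp : 1 ≤ p) (hJ : IsHomogeneousFunctional p J)
    (hcomp : HasPrecompactSublevels J) (hu : IsGradientFlow J f u) :
    ∃ q : H, J q = 0 ∧ Tendsto u atTop (𝓝 q) := by
  have hmem : ∀ n : ℕ, u (n + 1) ∈ closure {v : H | ((‖v‖ : ℝ) : EReal) + J v ≤
      ((‖u 1‖ + energy J u 1 : ℝ) : EReal)} := fun n => by
    refine subset_closure ?_
    have h1 : (1 : ℝ) ≤ n + 1 := by simp
    have hpos : (0 : ℝ) < n + 1 := by positivity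
    have h0 : (1 : ℝ) ∈ Set.Ioi 0 := zero_lt_one (α := ℝ)
    have ha := norm_sub_antitoneOn hp hJ hu hJ.hom.1 h0 hpos h1
    have hb := energy_antitoneOn hJ hu h0 hpos h1
    simp only [sub_zero] at ha
    rw [Set.mem_ofPred_eq, energy_coe hJ hu hpos]
    exact_mod_cast add_le_add ha hb
  obtain ⟨q, -, φ, hφ, hlim⟩ := (hcomp _).tendsto_subseq hmem
  have htime : Tendsto (fun n => ((φ n : ℕ) : ℝ) + 1) atTop atTop :=
    tendsto_atTop_add_const_right _ _ (tendsto_natCast_atTop_atTop.comp hφ.tendsto_atTop)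
  have hq : J q = 0 := by
    refine le_antisymm ?_ (nonneg_of_isAbsHomogeneous hJ.hom hJ.proper hJ.convex q)
    have h := le_of_tendsto_of_le hJ.lsc hlim ((tendsto_energy_zero hp hJ hu).comp htime)
      fun n => (energy_coe hJ hu (by positivity)).le
    simpa using h
  refine ⟨q, hq, Metric.tendsto_atTop.2 fun ε hε => ?_⟩
  obtain ⟨N, hN⟩ := (Metric.tendsto_atTop.1 hlim) ε hε
  refine ⟨φ N + 1, fun t ht => ?_⟩
  have hpos : (0 : ℝ) < φ N + 1 := by positivity
  have h := norm_sub_antitoneOn hp hJ hu hq hpos (hpos.trans_le ht) ht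
  rw [dist_eq_norm]
  refine lt_of_le_of_lt h ?_
  have := hN N le_rfl
  rwa [dist_eq_norm] at this

/-! ### The extinction time -/

/-- Either the limit is never reached, or it is reached first at some `τ > 0`. -/
theorem extinctionTime_cases (hu : IsGradientFlow J f u) {q : H} (hfq : f ≠ q) :
    extinctionTime u q = ⊤ ∨
      ∃ τ : ℝ, 0 < τ ∧ extinctionTime u q = (τ : EReal) ∧ u τ = q := by
  set S := {t : ℝ | 0 < t ∧ u t = q} with hS
  rcases S.eq_empty_or_nonempty with hne | hne
  · left
    rw [extinctionTime, ← hS, hne]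
    simp
  · right
    have hbdd : BddBelow S := ⟨0, fun t ht => ht.1.le⟩
    have hglb := isGLB_csInf hne hbdd
    have h0 : 0 ≤ sInf S := le_csInf hne fun t ht => ht.1.le
    have hclosed : IsClosed (Set.Ici (0 : ℝ) ∩ u ⁻¹' {q}) :=
      hu.continuousOn.preimage_isClosed_of_isClosed isClosed_Ici isClosed_singleton
    have hsub : S ⊆ Set.Ici (0 : ℝ) ∩ u ⁻¹' {q} := fun t ht => ⟨ht.1.le, ht.2⟩
    have hmem := closure_minimal hsub hclosed (csInf_mem_closure hne hbdd)
    refine ⟨sInf S, lt_of_le_of_ne h0 fun h => hfq ?_, ?_, hmem.2⟩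
    · have := hmem.2
      rw [← h] at this
      exact hu.initial.symm.trans this
    · refine IsGLB.sInf_eq ⟨?_, fun b hb => ?_⟩
      · rintro _ ⟨t, ht, rfl⟩
        exact EReal.coe_le_coe_iff.2 (hglb.1 ht)
      · induction b with
        | bot => exact bot_le
        | coe b =>
          exact EReal.coe_le_coe_iff.2 (hglb.2 fun t ht =>
            EReal.coe_le_coe_iff.1 (hb (Set.mem_image_of_mem _ ht)))
        | top =>
          obtain ⟨t, ht⟩ := hne
          exact absurd (top_le_iff.1 (hb (Set.mem_image_of_mem _ ht))) (EReal.coe_ne_top t)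

theorem extinctionTime_pos (hu : IsGradientFlow J f u) {q : H} (hfq : f ≠ q) :
    0 < extinctionTime u q := by
  rcases extinctionTime_cases hu hfq with h | ⟨τ, hτ, h, -⟩
  · simp [h]
  · rw [h]; exact_mod_cast hτ

theorem ne_of_lt_extinctionTime {X : Type*} {u : ℝ → X} {q : X} {t : ℝ} (ht : 0 < t)
    (htT : (t : EReal) < extinctionTime u q) : u t ≠ q := fun h =>
  absurd htT (not_lt.2 (sInf_le (Set.mem_image_of_mem _ ⟨ht, h⟩)))

theorem norm_sub_pos_of_lt_extinctionTime {E : Type*} [NormedAddCommGroup E] {u : ℝ → E} {q : E}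
    {t : ℝ} (ht : 0 < t)
    (htT : (t : EReal) < extinctionTime u q) : 0 < ‖u t - q‖ :=
  norm_pos_iff.2 (sub_ne_zero.2 (ne_of_lt_extinctionTime ht htT))

/-- The flow comes arbitrarily close to its limit strictly before the extinction time. -/
theorem exists_norm_sub_lt (hu : IsGradientFlow J f u) {q : H} (hfq : f ≠ q)
    (hlim : Tendsto u atTop (𝓝 q)) {a : ℝ} (haT : (a : EReal) < extinctionTime u q)
    {δ : ℝ} (hδ : 0 < δ) :
    ∃ t, a < t ∧ (t : EReal) < extinctionTime u q ∧ ‖u t - q‖ < δ := by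
  rcases extinctionTime_cases hu hfq with h | ⟨τ, hτ, h, huτ⟩
  · have hev := hlim.eventually (Metric.ball_mem_nhds q hδ)
    obtain ⟨t, ht, hat⟩ := (hev.and (eventually_gt_atTop a)).exists
    exact ⟨t, hat, by rw [h]; exact EReal.coe_lt_top t, by simpa [dist_eq_norm] using ht⟩
  · rw [h] at haT ⊢
    have haτ : a < τ := EReal.coe_lt_coe_iff.1 haT
    have hcont : ContinuousAt u τ := hu.continuousOn.continuousAt (Ici_mem_nhds hτ)
    have hball : Metric.ball q δ ∈ 𝓝 (u τ) := by rw [huτ]; exact Metric.ball_mem_nhds q hδ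
    have hev : ∀ᶠ t in 𝓝[<] τ, u t ∈ Metric.ball q δ :=
      nhdsWithin_le_nhds (hcont.eventually hball)
    obtain ⟨t, ht, hat⟩ := (hev.and (Ioo_mem_nhdsLT haτ)).exists
    exact ⟨t, hat.1, EReal.coe_lt_coe_iff.2 hat.2, by simpa [dist_eq_norm] using ht⟩

theorem eventually_toTimeLeft {T : EReal} {a : ℝ} (ha : (a : EReal) < T) :
    ∀ᶠ t in toTimeLeft T, a < t ∧ (t : EReal) < T := by
  have h : Set.Ioo (a : EReal) T ∈ 𝓝[<] T := Ioo_mem_nhdsLT ha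
  filter_upwards [preimage_mem_comap h] with t ht
  exact ⟨EReal.coe_lt_coe_iff.1 ht.1, ht.2⟩

/-! ### Monotonicity of the Rayleigh quotient -/

/-- The Rayleigh quotient as a real number, for times at which the energy is finite. -/
noncomputable def realRayleigh (J : H → EReal) (p : ℝ) (u : ℝ → H) (q : H) (t : ℝ) : ℝ :=
  p * energy J u t / ‖u t - q‖ ^ p

theorem rayleigh_eq_coe (hJ : IsHomogeneousFunctional p J) (hu : IsGradientFlow J f u) (q : H)
    {t : ℝ} (ht : 0 < t) : rayleigh J p u q t = (realRayleigh J p u q t : EReal) := by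
  rw [rayleigh, realRayleigh, energy_coe hJ hu ht, EReal.coe_div, EReal.coe_mul]

theorem realRayleigh_nonneg (hp : 1 ≤ p) (hJ : IsHomogeneousFunctional p J) (q : H) (t : ℝ) :
    0 ≤ realRayleigh J p u q t := by
  have := energy_nonneg hJ (u := u) t
  unfold realRayleigh
  positivity

/-- The function `Λ ^ 2 - 2 c log ‖u - q‖` whose monotonicity carries the argument. -/
noncomputable def lyapunov (J : H → EReal) (p c : ℝ) (u : ℝ → H) (q : H) (t : ℝ) : ℝ :=
  realRayleigh J p u q t ^ 2 - 2 * c * Real.log ‖u t - q‖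

/-- The squared distance between the rescaled subgradient `‖v‖ ^ (1 - p) ζ`, which lies in the
subdifferential at the profile `‖v‖⁻¹ v`, and the Rayleigh quotient times the profile, as
computed by Euler's identity; here `v = u t - q`. -/
noncomputable def defect (J : H → EReal) (p : ℝ) (u : ℝ → H) (q ζ : H) (t : ℝ) : ℝ :=
  ‖(‖u t - q‖⁻¹ ^ (p - 1)) • ζ‖ ^ 2 - realRayleigh J p u q t ^ 2

theorem hasDerivAt_norm_sub (hJ : IsHomogeneousFunctional p J) (hu : IsGradientFlow J f u)
    {q ζ : H} (hq : J q = 0) {t : ℝ} (ht : 0 < t) (hζ : IsDescent J u t ζ)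
    (hn : 0 < ‖u t - q‖) :
    HasDerivAt (fun s => ‖u s - q‖) (-(p * energy J u t) / ‖u t - q‖) t := by
  have h := (hasDerivAt_norm_sub_sq hJ hu hq ht hζ).sqrt (by positivity)
  simp only [Real.sqrt_sq (norm_nonneg _)] at h
  convert h using 1
  field_simp

theorem hasDerivAt_lyapunov (hJ : IsHomogeneousFunctional p J) (hu : IsGradientFlow J f u)
    {q ζ : H} (hq : J q = 0) {t : ℝ} (ht : 0 < t) (hζ : IsDescent J u t ζ)
    (he : HasDerivAt (energy J u) (-‖ζ‖ ^ 2) t) (hn : 0 < ‖u t - q‖) (c : ℝ) :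
    HasDerivAt (lyapunov J p c u q) (2 * realRayleigh J p u q t * ‖u t - q‖ ^ (p - 2) *
      (c - p * defect J p u q ζ t)) t := by
  have hnd := hasDerivAt_norm_sub hJ hu hq ht hζ hn
  have hΛ := ((he.const_mul p).div (hnd.rpow_const (p := p) (Or.inl hn.ne'))
    (Real.rpow_pos_of_pos hn p).ne').pow 2
  have h := hΛ.sub ((hnd.log hn.ne').const_mul (2 * c))
  refine h.congr_deriv ?_
  -- All powers of the norm are expressed through `n` and `n ^ (p - 2)`.
  set n := ‖u t - q‖ with hn_def
  set r := n ^ (p - 2) with hr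
  have hr0 : 0 < r := Real.rpow_pos_of_pos hn _
  have h1 : n ^ (p - 1) = r * n := by
    rw [hr, ← Real.rpow_add_one hn.ne']; congr 1; ring
  have h2 : n ^ p = r * n ^ 2 := by
    rw [sq, ← mul_assoc, ← h1, ← Real.rpow_add_one hn.ne']; congr 1; ring
  simp only [Pi.div_apply, Nat.add_one_sub_one, pow_one, Nat.cast_ofNat, realRayleigh, defect,
    norm_smul, mul_pow, Real.norm_eq_abs, sq_abs, Real.inv_rpow hn.le, ← hn_def, h1, h2]
  field_simp
  ring

theorem absolutelyContinuous_lyapunov (hJ : IsHomogeneousFunctional p J)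
    (hu : IsGradientFlow J f u) {q : H} {a b : ℝ} (ha : 0 < a) (hab : a ≤ b)
    (hpos : ∀ t ∈ Set.Icc a b, 0 < ‖u t - q‖) (c : ℝ) :
    AbsolutelyContinuousOnInterval (lyapunov J p c u q) a b := by
  obtain ⟨K, hK⟩ := lipschitzOnWith_norm_sub hu q ha
  obtain ⟨L, hL⟩ := energy_lipschitzOnWith hJ hu ha
  replace hK := hK.mono (Set.Icc_subset_Ici_self : Set.Icc a b ⊆ _)
  replace hL := hL.mono (Set.Icc_subset_Ici_self : Set.Icc a b ⊆ _)
  -- The function is smooth in `(J (u t), ‖u t - q‖)`, which ranges over the product of two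
  -- compact intervals, the second one inside `(0, ∞)`.
  obtain ⟨t₁, ht₁, hmin⟩ := isCompact_Icc.exists_isMinOn (Set.nonempty_Icc.2 hab) hK.continuousOn
  obtain ⟨t₂, -, hmax⟩ := isCompact_Icc.exists_isMaxOn (Set.nonempty_Icc.2 hab) hK.continuousOn
  obtain ⟨t₃, -, hmin'⟩ := isCompact_Icc.exists_isMinOn (Set.nonempty_Icc.2 hab) hL.continuousOn
  obtain ⟨t₄, -, hmax'⟩ := isCompact_Icc.exists_isMaxOn (Set.nonempty_Icc.2 hab) hL.continuousOn
  have hm := hpos t₁ ht₁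
  set B : Set (ℝ × ℝ) := Set.Icc (energy J u t₃) (energy J u t₄) ×ˢ
    Set.Icc ‖u t₁ - q‖ ‖u t₂ - q‖ with hB
  have hmaps : Set.MapsTo (fun t => (energy J u t, ‖u t - q‖)) (Set.Icc a b) B := fun t ht =>
    ⟨⟨hmin' ht, hmax' ht⟩, ⟨hmin ht, hmax ht⟩⟩
  have hsmooth : ContDiffOn ℝ 1
      (fun x : ℝ × ℝ => (p * x.1 / x.2 ^ p) ^ 2 - 2 * c * Real.log x.2) B := by
    intro x hx
    have hx2 : 0 < x.2 := hm.trans_le hx.2.1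
    have h2 : ContDiffAt ℝ 1 (fun y : ℝ × ℝ => y.2) x := contDiffAt_snd
    have h1 : ContDiffAt ℝ 1 (fun y : ℝ × ℝ => y.1) x := contDiffAt_fst
    have hr := h2.rpow_const_of_ne (p := p) hx2.ne'
    exact ((((contDiffAt_const.mul h1).div hr (Real.rpow_pos_of_pos hx2 p).ne').pow 2).sub
      (contDiffAt_const.mul (h2.log hx2.ne'))).contDiffWithinAt
  obtain ⟨M, hM⟩ := hsmooth.exists_lipschitzOnWith one_ne_zero
    ((convex_Icc _ _).prod (convex_Icc _ _)) (isCompact_Icc.prod isCompact_Icc)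
  have h := hM.comp (hL.prodMk hK) hmaps
  rw [← Set.uIcc_of_le hab] at h
  exact h.absolutelyContinuousOnInterval

/-- The Lyapunov function decreases as long as the defect is bounded below by `c / p`. -/
theorem lyapunov_le (hp : 1 ≤ p) (hJ : IsHomogeneousFunctional p J)
    (hu : IsGradientFlow J f u) {q : H} (hq : J q = 0) {a b c : ℝ} (ha : 0 < a) (hab : a ≤ b)
    (hbT : (b : EReal) < extinctionTime u q)
    (hc : ∀ t ∈ Set.Ioo a b, ∀ ζ, IsDescent J u t ζ → c ≤ p * defect J p u q ζ t) :
    lyapunov J p c u q b ≤ lyapunov J p c u q a := by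
  have hpos : ∀ t ∈ Set.Icc a b, 0 < ‖u t - q‖ := fun t ht =>
    norm_sub_pos_of_lt_extinctionTime (ha.trans_le ht.1)
      (lt_of_le_of_lt (EReal.coe_le_coe_iff.2 ht.2) hbT)
  refine le_of_ae_hasDerivAt_nonpos hab (absolutelyContinuous_lyapunov hJ hu ha hab hpos c) ?_
  filter_upwards [ae_hasDerivAt_energy hJ hu] with t ht hmem
  have ht0 : 0 < t := ha.trans hmem.1
  obtain ⟨ζ, hζ, he⟩ := ht ht0
  have hn := hpos t (Set.Ioo_subset_Icc_self hmem)
  refine ⟨_, hasDerivAt_lyapunov hJ hu hq ht0 hζ he hn c, ?_⟩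
  refine mul_nonpos_of_nonneg_of_nonpos ?_ (by linarith [hc t hmem ζ hζ])
  have := realRayleigh_nonneg hp hJ (u := u) q t
  positivity

theorem map_profile (hJ : IsHomogeneousFunctional p J) (hu : IsGradientFlow J f u)
    {q : H} (hq : J q = 0) {t : ℝ} (ht : 0 < t) (hn : 0 < ‖u t - q‖) :
    J (profile u q t) = ((‖u t - q‖⁻¹ ^ p * energy J u t : ℝ) : EReal) := by
  have h := hJ.hom.map_smul_coe (inv_ne_zero hn.ne')
    ((map_sub_of_map_eq_zero hJ.hom hJ.proper hJ.convex hq _).trans (energy_coe hJ hu ht))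
  rwa [abs_of_pos (inv_pos.2 hn)] at h

/-- The rescaled subgradient is a subgradient at the profile. -/
theorem smul_mem_subdiff_profile (hJ : IsHomogeneousFunctional p J) (hu : IsGradientFlow J f u)
    {q ζ : H} (hq : J q = 0) {t : ℝ} (ht : 0 < t) (hn : 0 < ‖u t - q‖)
    (hζ : IsDescent J u t ζ) :
    (‖u t - q‖⁻¹ ^ (p - 1)) • ζ ∈ subdiff J (profile u q t) :=
  smul_mem_subdiff hJ.hom hJ.proper (mem_subdiff_sub hJ.hom hJ.proper hJ.convex hq hζ.2)
    ((map_sub_of_map_eq_zero hJ.hom hJ.proper hJ.convex hq _).trans (energy_coe hJ hu ht))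
    (inv_pos.2 hn)

theorem mul_map_profile {E : Type*} [NormedAddCommGroup E] {J : E → EReal} {u : ℝ → E} (q : E)
    {t : ℝ} :
    p * (‖u t - q‖⁻¹ ^ p * energy J u t) = realRayleigh J p u q t := by
  rw [realRayleigh, Real.inv_rpow (norm_nonneg _)]
  ring

theorem norm_profile {q : H} {t : ℝ} (hn : 0 < ‖u t - q‖) : ‖profile u q t‖ = 1 := by
  rw [profile, norm_smul, norm_inv, norm_norm, inv_mul_cancel₀ hn.ne']

theorem norm_sub_sq_eq_defect (hJ : IsHomogeneousFunctional p J) (hu : IsGradientFlow J f u)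
    {q ζ : H} (hq : J q = 0) {t : ℝ} (ht : 0 < t) (hn : 0 < ‖u t - q‖)
    (hζ : IsDescent J u t ζ) :
    ‖(‖u t - q‖⁻¹ ^ (p - 1)) • ζ - realRayleigh J p u q t • profile u q t‖ ^ 2 =
      defect J p u q ζ t := by
  have h := inner_eq_of_mem_subdiff hJ.hom (smul_mem_subdiff_profile hJ hu hq ht hn hζ)
    (map_profile hJ hu hq ht hn)
  rw [mul_map_profile] at h
  rw [norm_sub_sq_real, real_inner_smul_right, h, norm_smul (realRayleigh J p u q t),
    norm_profile hn, defect, mul_one, Real.norm_eq_abs, sq_abs]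
  ring

theorem realRayleigh_antitone (hp : 1 ≤ p) (hJ : IsHomogeneousFunctional p J)
    (hu : IsGradientFlow J f u) {q : H} (hq : J q = 0) {a b : ℝ} (ha : 0 < a) (hab : a ≤ b)
    (hbT : (b : EReal) < extinctionTime u q) :
    realRayleigh J p u q b ≤ realRayleigh J p u q a := by
  have h := lyapunov_le hp hJ hu hq (c := 0) ha hab hbT fun t ht ζ hζ => by
    have ht0 := ha.trans ht.1
    have hn := norm_sub_pos_of_lt_extinctionTime ht0
      (lt_of_le_of_lt (EReal.coe_le_coe_iff.2 ht.2.le) hbT)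
    rw [← norm_sub_sq_eq_defect hJ hu hq ht0 hn hζ]
    positivity
  simp only [lyapunov, mul_zero, zero_mul, sub_zero] at h
  exact (sq_le_sq₀ (realRayleigh_nonneg hp hJ q b) (realRayleigh_nonneg hp hJ q a)).1 h

/-- Before the extinction time there are arbitrarily late times with small defect: otherwise the
Lyapunov function would be bounded above, although `-log ‖u - q‖` is not. -/
theorem exists_defect_lt (hp : 1 ≤ p) (hJ : IsHomogeneousFunctional p J)
    (hu : IsGradientFlow J f u) {q : H} (hq : J q = 0) (hfq : f ≠ q)
    (hlim : Tendsto u atTop (𝓝 q)) {a : ℝ} (ha : 0 < a) (haT : (a : EReal) < extinctionTime u q)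
    {ε : ℝ} (hε : 0 < ε) :
    ∃ t, a < t ∧ (t : EReal) < extinctionTime u q ∧
      ∃ ζ, IsDescent J u t ζ ∧ defect J p u q ζ t < ε := by
  by_contra! hcon
  have hpε : 0 < p * ε := by positivity
  -- The bound on the norm makes `-2 p ε log ‖u b - q‖` exceed the Lyapunov function at time `a`.
  obtain ⟨b, hab, hbT, hb⟩ := exists_norm_sub_lt hu hfq hlim haT
    (Real.exp_pos (-lyapunov J p (p * ε) u q a / (2 * (p * ε))))
  have h := lyapunov_le hp hJ hu hq (c := p * ε) ha hab.le hbT fun t ht ζ hζ => by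
    have := hcon t ht.1 (lt_trans (EReal.coe_lt_coe_iff.2 ht.2) hbT) ζ hζ
    gcongr
  have hn := norm_sub_pos_of_lt_extinctionTime (ha.trans hab) hbT
  have hlog := (Real.log_lt_iff_lt_exp hn).2 hb
  rw [lt_div_iff₀ (by positivity)] at hlog
  rw [lyapunov] at h
  nlinarith [sq_nonneg (realRayleigh J p u q b)]

/-! ### Limits before the extinction time -/

/-- The Rayleigh quotient converges, along `t → T`, to its infimum. -/
theorem exists_tendsto_realRayleigh (hp : 1 ≤ p) (hJ : IsHomogeneousFunctional p J)
    (hu : IsGradientFlow J f u) {q : H} (hq : J q = 0) (hfq : f ≠ q) :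
    ∃ L : ℝ, Tendsto (realRayleigh J p u q) (toTimeLeft (extinctionTime u q)) (𝓝 L) ∧
      IsGLB (realRayleigh J p u q '' {t : ℝ | 0 < t ∧ (t : EReal) < extinctionTime u q}) L := by
  set S := {t : ℝ | 0 < t ∧ (t : EReal) < extinctionTime u q} with hS
  have hT := extinctionTime_pos hu hfq
  have hne : S.Nonempty := by
    obtain ⟨t, h0, ht⟩ := EReal.lt_iff_exists_real_btwn.1 hT
    exact ⟨t, by exact_mod_cast h0, ht⟩
  have hbdd : BddBelow (realRayleigh J p u q '' S) := by
    refine ⟨0, ?_⟩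
    rintro _ ⟨t, -, rfl⟩
    exact realRayleigh_nonneg hp hJ q t
  have hglb := isGLB_csInf (hne.image _) hbdd
  refine ⟨_, tendsto_order.2 ⟨fun c hc => ?_, fun c hc => ?_⟩, hglb⟩
  · filter_upwards [eventually_toTimeLeft (a := 0) (by exact_mod_cast hT)] with t ht
    exact hc.trans_le (hglb.1 (Set.mem_image_of_mem _ ht))
  · obtain ⟨_, ⟨a, ha, rfl⟩, hac⟩ := exists_lt_of_csInf_lt (hne.image _) hc
    filter_upwards [eventually_toTimeLeft ha.2] with t ht
    exact (realRayleigh_antitone hp hJ hu hq ha.1 ht.1.le ht.2).trans_lt hac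

/-- A predicate that recurs before `T` is satisfied along a monotone sequence tending to `T`. -/
theorem exists_monotone_seq {T : EReal} (hT : 0 < T) {P : ℕ → ℝ → Prop}
    (hP : ∀ n, ∀ a : ℝ, 0 < a → (a : EReal) < T → ∃ t, a < t ∧ (t : EReal) < T ∧ P n t) :
    ∃ t : ℕ → ℝ, Monotone t ∧ (∀ n, 0 < t n ∧ (t n : EReal) < T ∧ P n (t n)) ∧
      Tendsto (fun n => (t n : EReal)) atTop (𝓝 T) := by
  obtain ⟨a, -, ha, hlim⟩ := exists_seq_strictMono_tendsto' hT
  have hα : ∀ n, ∃ α : ℝ, (α : EReal) = a n := fun n =>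
    ⟨(a n).toReal, EReal.coe_toReal ((ha n).2.trans_le le_top).ne
      (bot_le.trans_lt (ha n).1).ne'⟩
  choose α hα using hα
  have hα0 : ∀ n, 0 < α n := fun n => by
    have := (ha n).1
    rw [← hα n] at this
    exact_mod_cast this
  have hαT : ∀ n, (α n : EReal) < T := fun n => by rw [hα n]; exact (ha n).2
  choose! g hg hgT hgP using hP
  -- Each time is chosen after both the previous one and a prescribed sequence tending to `T`.
  obtain ⟨t, hzero, hsucc⟩ : ∃ t : ℕ → ℝ, t 0 = g 0 (α 0) ∧
      ∀ n, t (n + 1) = g (n + 1) (max (t n) (α (n + 1))) :=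
    ⟨fun n => Nat.rec (g 0 (α 0)) (fun n s => g (n + 1) (max s (α (n + 1)))) n, rfl, fun _ => rfl⟩
  have hmax : ∀ s : ℝ, (s : EReal) < T → ∀ n, ((max s (α n) : ℝ) : EReal) < T := by
    intro s hs n
    rcases max_choice s (α n) with h | h <;> rw [h]
    exacts [hs, hαT n]
  have hmain : ∀ n, α n < t n ∧ (t n : EReal) < T ∧ P n (t n) := by
    intro n
    induction n with
    | zero =>
      rw [hzero]
      exact ⟨hg 0 _ (hα0 0) (hαT 0), hgT 0 _ (hα0 0) (hαT 0), hgP 0 _ (hα0 0) (hαT 0)⟩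
    | succ n ih =>
      have h0 : 0 < max (t n) (α (n + 1)) := lt_max_of_lt_right (hα0 _)
      have hT' := hmax (t n) ih.2.1 (n + 1)
      rw [hsucc]
      exact ⟨(le_max_right _ _).trans_lt (hg _ _ h0 hT'), hgT _ _ h0 hT', hgP _ _ h0 hT'⟩
  refine ⟨t, monotone_nat_of_le_succ fun n => ?_, fun n =>
    ⟨(hα0 n).trans (hmain n).1, (hmain n).2⟩, ?_⟩
  · rw [hsucc]
    exact (le_max_left _ _).trans (hg _ _ (lt_max_of_lt_right (hα0 _))
      (hmax (t n) (hmain n).2.1 (n + 1))).le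
  · refine tendsto_of_tendsto_of_tendsto_of_le_of_le hlim tendsto_const_nhds (fun n => ?_)
      fun n => (hmain n).2.1.le
    rw [← hα n]
    exact EReal.coe_le_coe_iff.2 (hmain n).1.le

/-- The profiles have a limit point along times with vanishing defect, and it is an
eigenvector. -/
theorem exists_profile_limit (hp : 1 ≤ p) (hJ : IsHomogeneousFunctional p J)
    (hcomp : HasPrecompactSublevels J) (hu : IsGradientFlow J f u) {q : H} (hq : J q = 0)
    (hfq : f ≠ q) (hlim : Tendsto u atTop (𝓝 q)) {L : ℝ}
    (hL : Tendsto (realRayleigh J p u q) (toTimeLeft (extinctionTime u q)) (𝓝 L)) :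
    ∃ (t : ℕ → ℝ) (w : H), Monotone t ∧
      (∀ n, 0 ≤ t n ∧ (t n : EReal) < extinctionTime u q) ∧
      Tendsto (fun n => (t n : EReal)) atTop (𝓝 (extinctionTime u q)) ∧
      Tendsto (fun n => profile u q (t n)) atTop (𝓝 w) ∧ ‖w‖ = 1 ∧ L • w ∈ subdiff J w := by
  obtain ⟨t, hmono, ht, htT⟩ := exists_monotone_seq (extinctionTime_pos hu hfq)
    (P := fun n t => ∃ ζ, IsDescent J u t ζ ∧ defect J p u q ζ t < 1 / ((n : ℝ) + 1))
    fun n a ha haT => exists_defect_lt hp hJ hu hq hfq hlim ha haT (by positivity)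
  choose ht0 htlt ζ hζ hdef using ht
  have hn : ∀ n, 0 < ‖u (t n) - q‖ := fun n =>
    norm_sub_pos_of_lt_extinctionTime (ht0 n) (htlt n)
  have hmem : ∀ n, profile u q (t n) ∈ closure {v : H | ((‖v‖ : ℝ) : EReal) + J v ≤
      ((1 + realRayleigh J p u q (t 0) : ℝ) : EReal)} := fun n => by
    refine subset_closure ?_
    rw [Set.mem_ofPred_eq, norm_profile (hn n), map_profile hJ hu hq (ht0 n) (hn n)]
    have h1 := realRayleigh_antitone hp hJ hu hq (ht0 0) (hmono n.zero_le) (htlt n)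
    rw [← mul_map_profile (u := u) (J := J) q (t := t n)] at h1
    have h2 : 0 ≤ ‖u (t n) - q‖⁻¹ ^ p * energy J u (t n) := by
      have := energy_nonneg hJ (u := u) (t n)
      positivity
    have h3 : ‖u (t n) - q‖⁻¹ ^ p * energy J u (t n) ≤
        p * (‖u (t n) - q‖⁻¹ ^ p * energy J u (t n)) := le_mul_of_one_le_left h2 hp
    exact_mod_cast (by linarith : 1 + ‖u (t n) - q‖⁻¹ ^ p * energy J u (t n) ≤
      1 + realRayleigh J p u q (t 0))
  obtain ⟨w, -, φ, hφ, hw⟩ := (hcomp _).tendsto_subseq hmem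
  have htime : Tendsto t atTop (toTimeLeft (extinctionTime u q)) :=
    tendsto_comap_iff.2 (tendsto_nhdsWithin_iff.2 ⟨htT, Eventually.of_forall htlt⟩)
  have hη : Tendsto (fun n => (‖u (t n) - q‖⁻¹ ^ (p - 1)) • ζ n -
      realRayleigh J p u q (t n) • profile u q (t n)) atTop (𝓝 0) := by
    have hsq : Tendsto (fun n => ‖(‖u (t n) - q‖⁻¹ ^ (p - 1)) • ζ n -
        realRayleigh J p u q (t n) • profile u q (t n)‖ ^ 2) atTop (𝓝 0) := by
      refine squeeze_zero (fun n => sq_nonneg _) (fun n => ?_) tendsto_one_div_add_atTop_nhds_zero_nat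
      rw [norm_sub_sq_eq_defect hJ hu hq (ht0 n) (hn n) (hζ n)]
      exact (hdef n).le
    have h := hsq.sqrt
    simp only [Real.sqrt_sq (norm_nonneg _), Real.sqrt_zero] at h
    exact tendsto_zero_iff_norm_tendsto_zero.2 h
  have hφt := hφ.tendsto_atTop
  have hηL := (hη.comp hφt).add (((hL.comp htime).comp hφt).smul hw)
  simp only [Function.comp_def, sub_add_cancel, zero_add] at hηL
  refine ⟨t ∘ φ, w, hmono.comp hφ.monotone, fun n => ⟨(ht0 _).le, htlt _⟩, htT.comp hφt, hw, ?_,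
    mem_subdiff_of_tendsto hJ.proper hJ.lsc hw hηL fun n =>
      smul_mem_subdiff_profile hJ hu hq (ht0 _) (hn _) (hζ _)⟩
  refine tendsto_nhds_unique hw.norm ?_
  simp only [Function.comp_def, norm_profile (hn _)]
  exact tendsto_const_nhds

end GradFlow

theorem mainTheorem1 {H : Type*} [NormedAddCommGroup H] [InnerProductSpace ℝ H] [CompleteSpace H]
    (p : ℝ) (hp : 1 ≤ p) (J : H → EReal)
    (hhom : GradFlow.IsAbsHomogeneous p J) (hproper : GradFlow.IsProper J)
    (hconv : GradFlow.IsConvex J) (hlsc : LowerSemicontinuous J)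
    (hcomp : GradFlow.HasPrecompactSublevels J)
    (f : H) (hf : f ∈ closure (GradFlow.dom J))
    (u : ℝ → H) (hu : GradFlow.IsGradientFlow J f u) :
    ∃ uinf : H, Tendsto u atTop (𝓝 uinf) ∧
      (f ≠ uinf →
        ∃ Linf : ℝ,
          Tendsto (GradFlow.rayleigh J p u uinf)
            (GradFlow.toTimeLeft (GradFlow.extinctionTime u uinf)) (𝓝 (Linf : EReal)) ∧
          IsGLB (GradFlow.rayleigh J p u uinf ''
            {t : ℝ | 0 < t ∧ (t : EReal) < GradFlow.extinctionTime u uinf}) (Linf : EReal) ∧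
          ∃ (t : ℕ → ℝ) (winf : H),
            Monotone t ∧
            (∀ n, 0 ≤ t n ∧ (t n : EReal) < GradFlow.extinctionTime u uinf) ∧
            Tendsto (fun n => (t n : EReal)) atTop (𝓝 (GradFlow.extinctionTime u uinf)) ∧
            Tendsto (fun n => GradFlow.profile u uinf (t n)) atTop (𝓝 winf) ∧
            ‖winf‖ = 1 ∧
            Linf • winf ∈ GradFlow.subdiff J winf) := by
  have hJ : GradFlow.IsHomogeneousFunctional p J := ⟨hhom, hproper, hconv, hlsc⟩
  obtain ⟨q, hq, hlim⟩ := GradFlow.exists_tendsto_flow hp hJ hcomp hu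
  refine ⟨q, hlim, fun hfq => ?_⟩
  obtain ⟨L, hL, hglb⟩ := GradFlow.exists_tendsto_realRayleigh hp hJ hu hq hfq
  have hT := GradFlow.extinctionTime_pos hu hfq
  refine ⟨L, ?_, ⟨?_, fun b hb => ?_⟩,
    GradFlow.exists_profile_limit hp hJ hcomp hu hq hfq hlim hL⟩
  · refine (EReal.tendsto_coe.2 hL).congr' ?_
    filter_upwards [GradFlow.eventually_toTimeLeft (a := 0) (by exact_mod_cast hT)] with t ht
    exact (GradFlow.rayleigh_eq_coe hJ hu q ht.1).symm
  · rintro _ ⟨t, ht, rfl⟩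
    rw [GradFlow.rayleigh_eq_coe hJ hu q ht.1]
    exact EReal.coe_le_coe_iff.2 (hglb.1 (Set.mem_image_of_mem _ ht))
  · have hb' : ∀ t : ℝ, 0 < t → (t : EReal) < GradFlow.extinctionTime u q →
        b ≤ (GradFlow.realRayleigh J p u q t : EReal) := fun t h0 ht => by
      rw [← GradFlow.rayleigh_eq_coe hJ hu q h0]
      exact hb (Set.mem_image_of_mem _ ⟨h0, ht⟩)
    induction b with
    | bot => exact bot_le
    | coe b =>
      refine EReal.coe_le_coe_iff.2 (hglb.2 ?_)
      rintro _ ⟨t, ht, rfl⟩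
      exact EReal.coe_le_coe_iff.1 (hb' t ht.1 ht.2)
    | top =>
      obtain ⟨t, h0, ht⟩ := EReal.lt_iff_exists_real_btwn.1 hT
      exact absurd (top_le_iff.1 (hb' t (by exact_mod_cast h0) ht)) (EReal.coe_ne_top _)
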